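/- Let $L\ge 0$, let $n_0,\dots,n_{L+1}$ be layer widths and let $\gamma>0$. Consider a feedforward network $z_0=x$, $z_{k+1}=\sigma(W_kz_k+b_k)$ for $0\le k<L$, $y=W_Lz_L+b_L$, with weights $W_k\in\mathbb R^{n_{k+1}\times n_k}$, biases $b_k\in\mathbb R^{n_{k+1}}$ and a scalar activation $\sigma$ applied elementwise. The network is said to satisfy the LMI condition with bound $\gamma$ if there are diagonal matrices $\Lambda_k\in\mathbb R^{n_{k+1}\times n_{k+1}}$ ($0\le k<L$) with positive diagonal entries such that $$H=\begin{bmatrix}\gamma I & -\hat W_0^\top & & & \\ -\hat W_0 & 2\Lambda_0 & -\hat W_1^\top & & \\ & \ddots & \ddots & \ddots & \\ & & -\hat W_{L-1} & 2\Lambda_{L-1} & -\hat W_L^\top\\ & & & -\hat W_L & \gamma I\end{bmatrix}\succeq 0,$$ where $\hat W_k=\Lambda_kW_k$ for $0\le k<L$ and $\hat W_L=W_L$ (for $L=0$, $H=\begin{bmatrix}\gamma I&-W_0^\top\\-W_0&\gamma I\end{bmatrix}$). Theorem. The network satisfies the LMI condition with bound $\gamma$ if and only if there exist vectors $d_k\in\mathbb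 R^{n_{k+1}}$ ($0\le k<L$) and matrices $X_k\in\mathbb R^{n_{k+1}\times n_{k+1}}$, $Y_k\in\mathbb R^{n_k\times n_{k+1}}$ ($0\le k\le L$), all unconstrained, such that $$W_k=2\Psi_k^{-1}B_kA_{k-1}^\top\Psi_{k-1},\qquad k=0,\dots,L,$$ where $\Psi_k=\operatorname{diag}(e^{d_k})$ for $0\le k<L$, $\Psi_{-1}=\sqrt{\gamma/2}\,I$, $\Psi_L=\sqrt{2/\gamma}\,I$, $A_{-1}=I$, and, for $0\le k\le L$, $$\begin{bmatrix}A_k^\top\\ B_k^\top\end{bmatrix}=\begin{bmatrix}(I+Z_k)^{-1}(I-Z_k)\\ -2Y_k(I+Z_k)^{-1}\end{bmatrix},\qquad Z_k=X_k-X_k^\top+Y_k^\top Y_k$$ (the matrix $I+Z_k$ is always invertible). In other words, the image of the map $(d,X,Y)\mapsto(W_0,\dots,W_L)$, defined on the whole parameter space, is exactly the set of weights that satisfy the LMI condition with bound $\gamma$. -/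

import Mathlib

open scoped Matrix

noncomputable section

/-- An `L`-layer feedforward network with layer widths `n 0, …, n (L+1)`:
`z_0 = x`, `z_{k+1} = σ(W_k z_k + b_k)` for `k < L`, and `y = W_L z_L + b_L`. -/
structure FeedforwardNetwork (L : ℕ) (n : Fin (L + 2) → ℕ) where
  /-- The weight `W_k`, of size `n_{k+1} × n_k`, for `0 ≤ k ≤ L`. -/
  W : ∀ k : Fin (L + 1), Matrix (Fin (n k.succ)) (Fin (n k.castSucc)) ℝ
  /-- The bias `b_k`. -/
  b : ∀ k : Fin (L + 1), Fin (n k.succ) → ℝ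
  /-- The scalar activation function. -/
  σ : ℝ → ℝ

namespace FeedforwardNetwork

variable {L : ℕ} {n : Fin (L + 2) → ℕ}

/-- The hidden units `z_0, …, z_L` on the input `x`. -/
def hidden (f : FeedforwardNetwork L n) (x : Fin (n 0) → ℝ) (k : Fin (L + 1)) :
    Fin (n k.castSucc) → ℝ :=
  Fin.induction (motive := fun k : Fin (L + 1) => Fin (n k.castSucc) → ℝ) x
    (fun j z i => f.σ ((f.W j.castSucc *ᵥ z + f.b j.castSucc) i)) k

/-- The input-output map of the network. -/
def eval (f : FeedforwardNetwork L n) (x : Fin (n 0) → ℝ) : Fin (n (Fin.last (L + 1))) → ℝ :=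
  f.W (Fin.last L) *ᵥ f.hidden x (Fin.last L) + f.b (Fin.last L)

/-- `Ŵ_k = Λ_k W_k` for `k < L` and `Ŵ_L = W_L`, where `Λ_k = diag(lam k)`. -/
def scaledWeight (f : FeedforwardNetwork L n) (lam : ∀ j : Fin L, Fin (n j.castSucc.succ) → ℝ)
    (k : Fin (L + 1)) : Matrix (Fin (n k.succ)) (Fin (n k.castSucc)) ℝ :=
  Fin.lastCases
    (motive := fun k : Fin (L + 1) => Matrix (Fin (n k.succ)) (Fin (n k.castSucc)) ℝ)
    (f.W (Fin.last L)) (fun j => Matrix.diagonal (lam j) * f.W j.castSucc) k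

end FeedforwardNetwork

namespace LipschitzLMI

variable {L : ℕ} {n : Fin (L + 2) → ℕ}

/-- The diagonal blocks `γI, 2Λ_0, …, 2Λ_{L-1}, γI`. -/
def diagBlock (γ : ℝ) (lam : ∀ j : Fin L, Fin (n j.castSucc.succ) → ℝ) (i : Fin (L + 2)) :
    Matrix (Fin (n i)) (Fin (n i)) ℝ :=
  Fin.cases (motive := fun i : Fin (L + 2) => Matrix (Fin (n i)) (Fin (n i)) ℝ)
    (γ • 1)
    (fun k => Fin.lastCases
      (motive := fun k : Fin (L + 1) => Matrix (Fin (n k.succ)) (Fin (n k.succ)) ℝ)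
      (γ • 1) (fun j => (2 : ℝ) • Matrix.diagonal (lam j)) k) i

/-- The blocks of the matrix whose block in position `(k+1, k)` is `V k` and whose other blocks
vanish. -/
def subdiagBlock (V : ∀ k : Fin (L + 1), Matrix (Fin (n k.succ)) (Fin (n k.castSucc)) ℝ)
    (i j : Fin (L + 2)) : Matrix (Fin (n i)) (Fin (n j)) ℝ :=
  Fin.cases (motive := fun i : Fin (L + 2) => Matrix (Fin (n i)) (Fin (n j)) ℝ)
    0 (fun k => if h : k.castSucc = j then h ▸ V k else 0) i

/-- The block matrix with block `V k` in position `(k+1, k)` and zeros elsewhere. -/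
def subdiag (V : ∀ k : Fin (L + 1), Matrix (Fin (n k.succ)) (Fin (n k.castSucc)) ℝ) :
    Matrix (Σ i : Fin (L + 2), Fin (n i)) (Σ i : Fin (L + 2), Fin (n i)) ℝ :=
  fun p q => subdiagBlock V p.1 q.1 p.2 q.2

/-- The symmetric block tridiagonal matrix `H` with diagonal blocks
`γI, 2Λ_0, …, 2Λ_{L-1}, γI` and blocks `-Ŵ_0, …, -Ŵ_L` below the diagonal. -/
def H (γ : ℝ) (f : FeedforwardNetwork L n) (lam : ∀ j : Fin L, Fin (n j.castSucc.succ) → ℝ) :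
    Matrix (Σ i : Fin (L + 2), Fin (n i)) (Σ i : Fin (L + 2), Fin (n i)) ℝ :=
  Matrix.blockDiagonal' (diagBlock γ lam) - subdiag (f.scaledWeight lam)
    - (subdiag (f.scaledWeight lam))ᵀ

end LipschitzLMI

/-- The network satisfies the LMI with bound `γ`: `H ⪰ 0` for some positive diagonal multipliers
`Λ_0, …, Λ_{L-1}`. -/
def FeedforwardNetwork.SatisfiesLMI {L : ℕ} {n : Fin (L + 2) → ℕ} (f : FeedforwardNetwork L n)
    (γ : ℝ) : Prop :=
  ∃ lam : ∀ j : Fin L, Fin (n j.castSucc.succ) → ℝ,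
    (∀ j i, 0 < lam j i) ∧ (LipschitzLMI.H γ f lam).PosSemidef

section Cayley

variable {m p : Type*} [Fintype m] [DecidableEq m] [Fintype p]

/-- `Z = X - Xᵀ + Yᵀ Y`. -/
def cayleyZ (X : Matrix m m ℝ) (Y : Matrix p m ℝ) : Matrix m m ℝ :=
  X - Xᵀ + Yᵀ * Y

/-- The Cayley transform of the stacked matrix `[X; Y]`. -/
def cayley (X : Matrix m m ℝ) (Y : Matrix p m ℝ) : Matrix (m ⊕ p) m ℝ :=
  Matrix.fromRows ((1 + cayleyZ X Y)⁻¹ * (1 - cayleyZ X Y))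
    ((-2 : ℝ) • (Y * (1 + cayleyZ X Y)⁻¹))

/-- The inverse in the Cayley transform is a genuine one for all `X` and `Y`. -/
theorem isUnit_one_add_cayleyZ (X : Matrix m m ℝ) (Y : Matrix p m ℝ) :
    IsUnit (1 + cayleyZ X Y) := by
  rw [← Matrix.mulVec_injective_iff_isUnit]
  rw [← Matrix.coe_mulVecLin, ← LinearMap.ker_eq_bot, LinearMap.ker_eq_bot']
  intro v hv
  have h : v ⬝ᵥ ((1 + cayleyZ X Y) *ᵥ v) = 0 := by
    rw [← Matrix.mulVecLin_apply, hv, dotProduct_zero]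
  have hX : v ⬝ᵥ (Xᵀ *ᵥ v) = v ⬝ᵥ (X *ᵥ v) := by
    rw [Matrix.mulVec_transpose, dotProduct_comm, ← Matrix.dotProduct_mulVec]
  have hY : v ⬝ᵥ ((Yᵀ * Y) *ᵥ v) = (Y *ᵥ v) ⬝ᵥ (Y *ᵥ v) := by
    rw [← Matrix.mulVec_mulVec, Matrix.dotProduct_mulVec, Matrix.vecMul_transpose]
  rw [cayleyZ, Matrix.add_mulVec, Matrix.add_mulVec, Matrix.sub_mulVec, Matrix.one_mulVec,
    dotProduct_add, dotProduct_add, dotProduct_sub, hX, hY, sub_self, zero_add] at h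
  have h1 : 0 ≤ v ⬝ᵥ v := Finset.sum_nonneg fun i _ => mul_self_nonneg _
  have h2 : 0 ≤ (Y *ᵥ v) ⬝ᵥ (Y *ᵥ v) := Finset.sum_nonneg fun i _ => mul_self_nonneg _
  exact dotProduct_self_eq_zero.mp (by linarith)

end Cayley

/-- The free parameters: vectors `d_k` (`0 ≤ k < L`) of length `n_{k+1}` and matrices
`X_k`, `Y_k` (`0 ≤ k ≤ L`) of sizes `n_{k+1} × n_{k+1}` and `n_k × n_{k+1}`. -/
structure DirectParams (L : ℕ) (n : Fin (L + 2) → ℕ) where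
  d : ∀ j : Fin L, Fin (n j.castSucc.succ) → ℝ
  X : ∀ k : Fin (L + 1), Matrix (Fin (n k.succ)) (Fin (n k.succ)) ℝ
  Y : ∀ k : Fin (L + 1), Matrix (Fin (n k.castSucc)) (Fin (n k.succ)) ℝ

namespace DirectParams

variable {L : ℕ} {n : Fin (L + 2) → ℕ}

/-- `A_k` for `0 ≤ k ≤ L`: the transpose of the upper block of the Cayley transform. -/
def A (θ : DirectParams L n) (k : Fin (L + 1)) : Matrix (Fin (n k.succ)) (Fin (n k.succ)) ℝ :=
  (Matrix.toRows₁ (cayley (θ.X k) (θ.Y k)))ᵀ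

/-- `B_k` for `0 ≤ k ≤ L`: the transpose of the lower block of the Cayley transform. -/
def B (θ : DirectParams L n) (k : Fin (L + 1)) :
    Matrix (Fin (n k.succ)) (Fin (n k.castSucc)) ℝ :=
  (Matrix.toRows₂ (cayley (θ.X k) (θ.Y k)))ᵀ

/-- `Ψ_k = diag(exp d_k)` for `0 ≤ k < L` and `Ψ_L = √(2/γ) I`. -/
def Ψ (γ : ℝ) (θ : DirectParams L n) (k : Fin (L + 1)) :
    Matrix (Fin (n k.succ)) (Fin (n k.succ)) ℝ :=
  Fin.lastCases
    (motive := fun k : Fin (L + 1) => Matrix (Fin (n k.succ)) (Fin (n k.succ)) ℝ)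
    (√(2 / γ) • 1) (fun j => Matrix.diagonal fun i => Real.exp (θ.d j i)) k

/-- `A_{k-1}` for `0 ≤ k ≤ L + 1`, where `A_{-1} = I`. -/
def prevA (θ : DirectParams L n) (k : Fin (L + 2)) : Matrix (Fin (n k)) (Fin (n k)) ℝ :=
  Fin.cases (motive := fun k : Fin (L + 2) => Matrix (Fin (n k)) (Fin (n k)) ℝ)
    1 (fun j => θ.A j) k

/-- `Ψ_{k-1}` for `0 ≤ k ≤ L + 1`, where `Ψ_{-1} = √(γ/2) I`. -/
def prevΨ (γ : ℝ) (θ : DirectParams L n) (k : Fin (L + 2)) :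
    Matrix (Fin (n k)) (Fin (n k)) ℝ :=
  Fin.cases (motive := fun k : Fin (L + 2) => Matrix (Fin (n k)) (Fin (n k)) ℝ)
    (√(γ / 2) • 1) (fun j => θ.Ψ γ j) k

/-- `W_k = 2 Ψ_k⁻¹ B_k A_{k-1}ᵀ Ψ_{k-1}` for `0 ≤ k ≤ L`. -/
def weight (γ : ℝ) (θ : DirectParams L n) (k : Fin (L + 1)) :
    Matrix (Fin (n k.succ)) (Fin (n k.castSucc)) ℝ :=
  (2 : ℝ) • ((θ.Ψ γ k)⁻¹ * θ.B k * (θ.prevA k.castSucc)ᵀ * θ.prevΨ γ k.castSucc)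

end DirectParams

end

/-! A diagonal congruence scales the diagonal blocks of `H` to identities. The scaled matrix is
positive semidefinite if and only if it has a block factorization `R Rᵀ`, where `R` has blocks
`I, A_0, …, A_L` on the diagonal and `-B_0, …, -B_L` below it. Comparing blocks, this means that
`A_k A_kᵀ + B_k B_kᵀ = I` and that the scaled weights are `B_k A_{k-1}ᵀ`. Successive Schur
complements (with possibly singular pivots) provide such a factorization, and their square roots
allow `A_k ⪰ 0`; then `I + A_kᵀ` is invertible, which is the condition for `[A_kᵀ; B_kᵀ]`, whose
columns are orthonormal, to be a Cayley transform. -/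

section MatrixFactorization

variable {K : Type*} [Field K] {l m p : Type*} [Fintype m] [Fintype p]

theorem exists_eq_mul_of_mulVec_eq_zero {S : Matrix p m K} {U : Matrix l m K}
    (h : ∀ v, S *ᵥ v = 0 → U *ᵥ v = 0) : ∃ C : Matrix l p K, U = C * S := by
  classical
  obtain ⟨s, hs⟩ := S.mulVecLin.rangeRestrict.exists_rightInverse_of_surjective
    S.mulVecLin.range_rangeRestrict
  obtain ⟨c, hc⟩ := (U.mulVecLin ∘ₗ s).exists_extend
  refine ⟨LinearMap.toMatrix' c, Matrix.ext_of_mulVec_single fun i => ?_⟩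
  set v : m → K := Pi.single i 1
  have hsv : S *ᵥ (s (S.mulVecLin.rangeRestrict v)) = S *ᵥ v :=
    congrArg Subtype.val (LinearMap.congr_fun hs (S.mulVecLin.rangeRestrict v))
  have hcv : c (S *ᵥ v) = U *ᵥ (s (S.mulVecLin.rangeRestrict v)) :=
    LinearMap.congr_fun hc (S.mulVecLin.rangeRestrict v)
  rw [← Matrix.mulVec_mulVec, LinearMap.toMatrix'_mulVec, hcv, ← sub_eq_zero,
    ← Matrix.mulVec_sub]
  exact h _ (by rw [Matrix.mulVec_sub, hsv, sub_self])

end MatrixFactorization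

section CayleyStiefel

variable {m p : Type*} [Fintype m] [DecidableEq m] [Fintype p]

theorem cayley_eq_fromRows (X : Matrix m m ℝ) (Y : Matrix p m ℝ) :
    cayley X Y = Matrix.fromRows ((2 : ℝ) • (1 + cayleyZ X Y)⁻¹ - 1)
      ((-2 : ℝ) • (Y * (1 + cayleyZ X Y)⁻¹)) := by
  have hZ : 1 - cayleyZ X Y = (2 : ℝ) • 1 - (1 + cayleyZ X Y) := by rw [two_smul]; abel
  rw [cayley, hZ, mul_sub, Matrix.nonsing_inv_mul _
    ((Matrix.isUnit_iff_isUnit_det _).mp (isUnit_one_add_cayleyZ X Y)), mul_smul_comm, mul_one]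

theorem cayley_transpose_mul_self (X : Matrix m m ℝ) (Y : Matrix p m ℝ) :
    (cayley X Y)ᵀ * cayley X Y = 1 := by
  set C := (1 + cayleyZ X Y)⁻¹ with hC
  have hdet := (Matrix.isUnit_iff_isUnit_det _).mp (isUnit_one_add_cayleyZ X Y)
  have hZC : (1 + cayleyZ X Y) * C = 1 := Matrix.mul_nonsing_inv _ hdet
  have hCZ : Cᵀ * (1 + cayleyZ X Y)ᵀ = 1 := by
    rw [← Matrix.transpose_mul, hZC, Matrix.transpose_one]
  have hsymm : (1 + cayleyZ X Y)ᵀ + (1 + cayleyZ X Y) = (2 : ℝ) • (1 + Yᵀ * Y) := by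
    simp only [cayleyZ, Matrix.transpose_add, Matrix.transpose_sub, Matrix.transpose_mul,
      Matrix.transpose_one, Matrix.transpose_transpose]
    module
  have hadd : C + Cᵀ = (2 : ℝ) • (Cᵀ * (1 + Yᵀ * Y) * C) := by
    calc C + Cᵀ = Cᵀ * (1 + cayleyZ X Y)ᵀ * C + Cᵀ * ((1 + cayleyZ X Y) * C) := by
          rw [hCZ, hZC, one_mul, mul_one]
      _ = Cᵀ * ((1 + cayleyZ X Y)ᵀ + (1 + cayleyZ X Y)) * C := by noncomm_ring
      _ = (2 : ℝ) • (Cᵀ * (1 + Yᵀ * Y) * C) := by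
          rw [hsymm, Matrix.mul_smul, Matrix.smul_mul]
  rw [cayley_eq_fromRows, Matrix.transpose_fromRows, Matrix.fromCols_mul_fromRows, ← hC]
  have hexp : Cᵀ * (1 + Yᵀ * Y) * C = Cᵀ * C + Cᵀ * Yᵀ * (Y * C) := by
    simp only [mul_add, add_mul, mul_one, Matrix.mul_assoc]
  simp only [Matrix.transpose_sub, Matrix.transpose_smul, Matrix.transpose_one,
    Matrix.transpose_mul, Matrix.smul_mul, Matrix.mul_smul, sub_mul, mul_sub, one_mul, mul_one]
  linear_combination (norm := module) (-2 : ℝ) • hadd - (4 : ℝ) • hexp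

theorem exists_cayley_eq_fromRows {A : Matrix m m ℝ} {B : Matrix m p ℝ}
    (hAB : A * Aᵀ + B * Bᵀ = 1) (hA : IsUnit (1 + Aᵀ)) :
    ∃ X Y, cayley X Y = Matrix.fromRows Aᵀ Bᵀ := by
  -- The upper block forces `1 + Z = 2 E`, the lower one `Y = -Bᵀ E`; `X = E` then fits, since
  -- `A Aᵀ + B Bᵀ = 1` says that `Yᵀ Y = E + Eᵀ - 1`.
  set E := (1 + Aᵀ)⁻¹
  have hdet := (Matrix.isUnit_iff_isUnit_det _).mp hA
  have hAE : (1 + Aᵀ) * E = 1 := Matrix.mul_nonsing_inv _ hdet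
  have hEA : Eᵀ * (1 + A) = 1 := by
    simpa using congrArg Matrix.transpose hAE
  have hEE : E + Eᵀ - 1 = Eᵀ * (B * Bᵀ) * E := by
    calc E + Eᵀ - 1
        = Eᵀ * (1 + A) * E + Eᵀ * ((1 + Aᵀ) * E) - Eᵀ * (1 + A) * ((1 + Aᵀ) * E) := by
          rw [hAE, hEA, one_mul, mul_one, mul_one]
      _ = Eᵀ * (1 - A * Aᵀ) * E := by noncomm_ring
      _ = Eᵀ * (B * Bᵀ) * E := by rw [← hAB, add_sub_cancel_left]
  have hZ : 1 + cayleyZ E (-(Bᵀ * E)) = (2 : ℝ) • E := by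
    have : (-(Bᵀ * E))ᵀ * -(Bᵀ * E) = Eᵀ * (B * Bᵀ) * E := by
      simp [Matrix.mul_assoc]
    rw [cayleyZ, this, ← hEE]
    module
  have hinv : (1 + cayleyZ E (-(Bᵀ * E)))⁻¹ = (2⁻¹ : ℝ) • (1 + Aᵀ) :=
    Matrix.inv_eq_right_inv (by
      rw [hZ, Matrix.smul_mul, Matrix.mul_smul, smul_smul, Matrix.nonsing_inv_mul _ hdet]; norm_num)
  refine ⟨E, -(Bᵀ * E), ?_⟩
  rw [cayley_eq_fromRows, hinv]
  congr 1
  · module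
  · rw [Matrix.mul_smul, Matrix.neg_mul, Matrix.mul_assoc, Matrix.nonsing_inv_mul _ hdet,
      Matrix.mul_one, smul_neg, smul_neg, smul_smul]
    norm_num

end CayleyStiefel

section ChainForm

variable {L : ℕ} {ι : Fin (L + 1) → Type*} [∀ i, Fintype (ι i)]

/-- The quadratic form of the symmetric block tridiagonal matrix with diagonal blocks
`S, 1, …, 1` and blocks `-U 0, …, -U (L - 1)` below the diagonal. -/
noncomputable def chainForm (S : Matrix (ι 0) (ι 0) ℝ)
    (U : ∀ k : Fin L, Matrix (ι k.succ) (ι k.castSucc) ℝ) (x : ∀ i, ι i → ℝ) : ℝ :=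
  x 0 ⬝ᵥ S *ᵥ x 0 +
    ∑ k : Fin L, (x k.succ ⬝ᵥ x k.succ - 2 * (x k.succ ⬝ᵥ U k *ᵥ x k.castSucc))

theorem chainForm_single_zero (S : Matrix (ι 0) (ι 0) ℝ)
    (U : ∀ k : Fin L, Matrix (ι k.succ) (ι k.castSucc) ℝ) (v : ι 0 → ℝ) :
    chainForm S U (Pi.single 0 v) = v ⬝ᵥ S *ᵥ v := by
  simp [chainForm, Fin.succ_ne_zero]

theorem posSemidef_of_chainForm_nonneg {S : Matrix (ι 0) (ι 0) ℝ} (hS : S.IsHermitian)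
    {U : ∀ k : Fin L, Matrix (ι k.succ) (ι k.castSucc) ℝ} (hx : ∀ x, 0 ≤ chainForm S U x) :
    S.PosSemidef :=
  .of_dotProduct_mulVec_nonneg hS fun v =>
    (hx (Pi.single 0 v)).trans_eq (chainForm_single_zero S U v)

variable {ι : Fin (L + 2) → Type*} [∀ i, Fintype (ι i)]

theorem chainForm_cons [DecidableEq (ι (Fin.succ 0))] (S : Matrix (ι 0) (ι 0) ℝ)
    {U : ∀ k : Fin (L + 1), Matrix (ι k.succ) (ι k.castSucc) ℝ}
    {U₀ : Matrix (ι (Fin.succ 0)) (ι 0) ℝ} (hU : U 0 = U₀)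
    (v : ι 0 → ℝ) (y : ∀ i : Fin (L + 1), ι i.succ → ℝ) :
    chainForm S U (Fin.cons v y : ∀ i, ι i → ℝ) =
      v ⬝ᵥ S *ᵥ v - 2 * (y 0 ⬝ᵥ U₀ *ᵥ v) +
        chainForm (ι := fun i => ι i.succ) 1 (fun k => U k.succ) y := by
  calc chainForm S U (Fin.cons v y : ∀ i, ι i → ℝ)
      = v ⬝ᵥ S *ᵥ v + (y 0 ⬝ᵥ y 0 - 2 * (y 0 ⬝ᵥ U₀ *ᵥ v) + ∑ k : Fin L,
          (y k.succ ⬝ᵥ y k.succ - 2 * (y k.succ ⬝ᵥ U k.succ *ᵥ y k.castSucc))) := by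
        rw [chainForm, Fin.sum_univ_succ, ← hU]
        rfl
    _ = _ := by
        simp only [chainForm, Matrix.one_mulVec]
        ring

theorem mulVec_eq_zero_of_chainForm_nonneg {S : Matrix (ι 0) (ι 0) ℝ}
    {U : ∀ k : Fin (L + 1), Matrix (ι k.succ) (ι k.castSucc) ℝ}
    (hx : ∀ x, 0 ≤ chainForm S U x) {v : ι 0 → ℝ} (hv : S *ᵥ v = 0) : U 0 *ᵥ v = 0 := by
  classical
  set w : ι (Fin.succ 0) → ℝ := U 0 *ᵥ v
  have h : chainForm S U (Fin.cons v (Pi.single 0 w)) = -(w ⬝ᵥ w) := by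
    rw [chainForm_cons S rfl, chainForm_single_zero, hv, Matrix.one_mulVec, Pi.single_eq_same,
      dotProduct_zero]
    change 0 - 2 * (w ⬝ᵥ w) + w ⬝ᵥ w = -(w ⬝ᵥ w)
    ring
  exact dotProduct_self_eq_zero.mp
    (le_antisymm (neg_nonneg.mp (h ▸ hx _)) (dotProduct_self_star_nonneg w))

theorem chainForm_cons_transpose_mulVec [DecidableEq (ι (Fin.succ 0))] {S : Matrix (ι 0) (ι 0) ℝ}
    {U : ∀ k : Fin (L + 1), Matrix (ι k.succ) (ι k.castSucc) ℝ}
    {C : Matrix (ι (Fin.succ 0)) (ι 0) ℝ} (hU : U 0 = C * S)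
    (y : ∀ i : Fin (L + 1), ι i.succ → ℝ) :
    chainForm S U (Fin.cons (Cᵀ *ᵥ y 0) y : ∀ i, ι i → ℝ) =
      chainForm (ι := fun i => ι i.succ) (1 - C * S * Cᵀ) (fun k => U k.succ) y := by
  have hSC : Cᵀ *ᵥ y 0 ⬝ᵥ S *ᵥ Cᵀ *ᵥ y 0 = y 0 ⬝ᵥ (C * S * Cᵀ) *ᵥ y 0 := by
    rw [dotProduct_comm, Matrix.dotProduct_transpose_mulVec, Matrix.mulVec_mulVec,
      Matrix.mulVec_mulVec]
  rw [chainForm_cons S hU, hSC, Matrix.mulVec_mulVec]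
  simp only [chainForm, Matrix.sub_mulVec, dotProduct_sub]
  ring

end ChainForm

section ChainFactorization

open scoped MatrixOrder

theorem exists_chain_ldl {L : ℕ} {ι : Fin (L + 1) → Type*} [∀ i, Fintype (ι i)]
    [∀ i, DecidableEq (ι i)] {S₀ : Matrix (ι 0) (ι 0) ℝ} (hS₀ : S₀.IsHermitian)
    {U : ∀ k : Fin L, Matrix (ι k.succ) (ι k.castSucc) ℝ} (hx : ∀ x, 0 ≤ chainForm S₀ U x) :
    ∃ (S : ∀ i, Matrix (ι i) (ι i) ℝ) (C : ∀ k : Fin L, Matrix (ι k.succ) (ι k.castSucc) ℝ),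
      S 0 = S₀ ∧ (∀ i, (S i).PosSemidef) ∧
        ∀ k, S k.succ + C k * S k.castSucc * (C k)ᵀ = 1 ∧ U k = C k * S k.castSucc := by
  induction L with
  | zero =>
    exact ⟨Fin.cons S₀ finZeroElim, finZeroElim, rfl,
      Fin.cases (posSemidef_of_chainForm_nonneg hS₀ hx) finZeroElim, finZeroElim⟩
  | succ L ih =>
    obtain ⟨C₀, hC₀⟩ := exists_eq_mul_of_mulVec_eq_zero
      fun v => mulVec_eq_zero_of_chainForm_nonneg hx (v := v)
    have hherm : (1 - C₀ * S₀ * C₀ᵀ).IsHermitian :=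
      Matrix.isHermitian_one.sub (Matrix.isHermitian_mul_mul_conjTranspose C₀ hS₀)
    have hnonneg : ∀ y, 0 ≤ chainForm (ι := fun i => ι i.succ) (1 - C₀ * S₀ * C₀ᵀ)
        (fun k => U k.succ) y :=
      fun y => (hx _).trans_eq (chainForm_cons_transpose_mulVec hC₀ y)
    obtain ⟨S, C, hS0, hS, hSC⟩ := ih (ι := fun i => ι i.succ) hherm hnonneg
    refine ⟨Fin.cons S₀ S, Fin.cons C₀ C, rfl,
      Fin.cases (posSemidef_of_chainForm_nonneg hS₀ hx) hS, Fin.cases ⟨?_, hC₀⟩ hSC⟩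
    change S 0 + C₀ * S₀ * C₀ᵀ = 1
    rw [hS0, sub_add_cancel]

theorem exists_chain_factorization {L : ℕ} {ι : Fin (L + 1) → Type*} [∀ i, Fintype (ι i)]
    [∀ i, DecidableEq (ι i)] {U : ∀ k : Fin L, Matrix (ι k.succ) (ι k.castSucc) ℝ}
    (hx : ∀ x, 0 ≤ chainForm 1 U x) :
    ∃ (A : ∀ i, Matrix (ι i) (ι i) ℝ) (B : ∀ k : Fin L, Matrix (ι k.succ) (ι k.castSucc) ℝ),
      A 0 = 1 ∧ (∀ i, (A i).PosSemidef) ∧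
        ∀ k, A k.succ * (A k.succ)ᵀ + B k * (B k)ᵀ = 1 ∧ U k = B k * (A k.castSucc)ᵀ := by
  obtain ⟨S, C, hS0, hS, hSC⟩ := exists_chain_ldl Matrix.isHermitian_one hx
  have hA : ∀ i, (CFC.sqrt (S i)).PosSemidef :=
    fun i => Matrix.nonneg_iff_posSemidef.mp (CFC.sqrt_nonneg (S i))
  have hAA : ∀ i, CFC.sqrt (S i) * (CFC.sqrt (S i))ᵀ = S i := fun i => by
    rw [← Matrix.conjTranspose_eq_transpose_of_trivial, (hA i).isHermitian.eq,
      CFC.sqrt_mul_sqrt_self (S i) (hS i).nonneg]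
  refine ⟨fun i => CFC.sqrt (S i), fun k => C k * CFC.sqrt (S k.castSucc),
    (congrArg CFC.sqrt hS0).trans CFC.sqrt_one, hA, fun k => ⟨?_, ?_⟩⟩
  · rw [Matrix.transpose_mul, ← Matrix.mul_assoc, Matrix.mul_assoc (C k), hAA, hAA, (hSC k).1]
  · rw [Matrix.mul_assoc, hAA, (hSC k).2]

end ChainFactorization

namespace LipschitzLMI

variable {L : ℕ} {n : Fin (L + 2) → ℕ}
  {V : ∀ k : Fin (L + 1), Matrix (Fin (n k.succ)) (Fin (n k.castSucc)) ℝ}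

theorem subdiag_zero_apply (a : Fin (n 0)) (q : Σ i, Fin (n i)) : subdiag V ⟨0, a⟩ q = 0 := rfl

theorem subdiag_succ_castSucc_apply (k : Fin (L + 1)) (a : Fin (n k.succ))
    (b : Fin (n k.castSucc)) : subdiag V ⟨k.succ, a⟩ ⟨k.castSucc, b⟩ = V k a b := by
  simp [subdiag, subdiagBlock]

theorem subdiag_succ_apply_of_ne {k : Fin (L + 1)} {j : Fin (L + 2)} (h : k.castSucc ≠ j)
    (a : Fin (n k.succ)) (b : Fin (n j)) : subdiag V ⟨k.succ, a⟩ ⟨j, b⟩ = 0 := by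
  simp [subdiag, subdiagBlock, h]

theorem sum_subdiag_succ_mul (k : Fin (L + 1)) (a : Fin (n k.succ)) (g : (Σ i, Fin (n i)) → ℝ) :
    ∑ q, subdiag V ⟨k.succ, a⟩ q * g q = ∑ b, V k a b * g ⟨k.castSucc, b⟩ := by
  rw [Fintype.sum_sigma, Finset.sum_eq_single k.castSucc]
  · simp only [subdiag_succ_castSucc_apply]
  · intro j _ hj
    simp only [subdiag_succ_apply_of_ne hj.symm, zero_mul, Finset.sum_const_zero]
  · simp

theorem dotProduct_subdiag_mulVec (x : ∀ i, Fin (n i) → ℝ) :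
    (fun p : Σ i, Fin (n i) => x p.1 p.2) ⬝ᵥ subdiag V *ᵥ (fun p => x p.1 p.2) =
      ∑ k, x k.succ ⬝ᵥ V k *ᵥ x k.castSucc := by
  rw [dotProduct, Fintype.sum_sigma, Fin.sum_univ_succ]
  simp only [Matrix.mulVec, dotProduct, subdiag_zero_apply, sum_subdiag_succ_mul, zero_mul,
    mul_zero, Finset.sum_const_zero, zero_add]

theorem subdiag_mul_blockDiagonal' (D : ∀ i, Matrix (Fin (n i)) (Fin (n i)) ℝ) :
    subdiag V * Matrix.blockDiagonal' D = subdiag fun k => V k * D k.castSucc := by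
  ext ⟨i, a⟩ ⟨j, b⟩
  rw [Matrix.mul_apply]
  cases i using Fin.cases with
  | zero => simp only [subdiag_zero_apply, zero_mul, Finset.sum_const_zero]
  | succ k =>
    rw [sum_subdiag_succ_mul]
    by_cases h : k.castSucc = j
    · subst h
      simp only [Matrix.blockDiagonal'_apply_eq, subdiag_succ_castSucc_apply, Matrix.mul_apply]
    · simp only [Matrix.blockDiagonal'_apply_ne _ _ _ h, subdiag_succ_apply_of_ne h, mul_zero,
        Finset.sum_const_zero]

theorem blockDiagonal'_mul_subdiag (D : ∀ i, Matrix (Fin (n i)) (Fin (n i)) ℝ) :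
    Matrix.blockDiagonal' D * subdiag V = subdiag fun k => D k.succ * V k := by
  ext ⟨i, a⟩ ⟨j, b⟩
  rw [Matrix.mul_apply, Fintype.sum_sigma, Finset.sum_eq_single i
    (fun l _ hl => by simp only [Matrix.blockDiagonal'_apply_ne _ _ _ hl.symm, zero_mul,
      Finset.sum_const_zero]) (by simp)]
  cases i using Fin.cases with
  | zero => simp only [subdiag_zero_apply, mul_zero, Finset.sum_const_zero]
  | succ k =>
    by_cases h : k.castSucc = j
    · subst h
      simp only [Matrix.blockDiagonal'_apply_eq, subdiag_succ_castSucc_apply, Matrix.mul_apply]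
    · simp only [subdiag_succ_apply_of_ne h, mul_zero, Finset.sum_const_zero]

theorem subdiag_mul_transpose_self {D : ∀ i, Matrix (Fin (n i)) (Fin (n i)) ℝ} (h₀ : D 0 = 0)
    (hD : ∀ k : Fin (L + 1), D k.succ = V k * (V k)ᵀ) :
    subdiag V * (subdiag V)ᵀ = Matrix.blockDiagonal' D := by
  ext ⟨i, a⟩ ⟨j, b⟩
  simp only [Matrix.mul_apply, Matrix.transpose_apply]
  cases i using Fin.cases with
  | zero =>
    by_cases h : 0 = j
    · subst h
      simp [Matrix.blockDiagonal'_apply_eq, h₀, subdiag_zero_apply]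
    · simp only [subdiag_zero_apply, zero_mul, Finset.sum_const_zero,
        Matrix.blockDiagonal'_apply_ne _ _ _ h]
  | succ k =>
    rw [sum_subdiag_succ_mul]
    cases j using Fin.cases with
    | zero =>
      simp only [subdiag_zero_apply, mul_zero, Finset.sum_const_zero,
        Matrix.blockDiagonal'_apply_ne _ _ _ (Fin.succ_ne_zero k)]
    | succ l =>
      by_cases h : l = k
      · subst h
        simp only [subdiag_succ_castSucc_apply, Matrix.blockDiagonal'_apply_eq, hD,
          Matrix.mul_apply, Matrix.transpose_apply]
      · simp only [subdiag_succ_apply_of_ne (Fin.castSucc_injective _ |>.ne h), mul_zero,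
          Finset.sum_const_zero,
          Matrix.blockDiagonal'_apply_ne _ _ _ (Fin.succ_injective _ |>.ne (Ne.symm h))]

/-- The symmetric block tridiagonal matrix with identity diagonal blocks and blocks `-U k` below the
diagonal, to which `H` is congruent. -/
def unitTridiag (U : ∀ k : Fin (L + 1), Matrix (Fin (n k.succ)) (Fin (n k.castSucc)) ℝ) :
    Matrix (Σ i : Fin (L + 2), Fin (n i)) (Σ i : Fin (L + 2), Fin (n i)) ℝ :=
  1 - subdiag U - (subdiag U)ᵀ

variable {U : ∀ k : Fin (L + 1), Matrix (Fin (n k.succ)) (Fin (n k.castSucc)) ℝ}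

theorem dotProduct_unitTridiag_mulVec (x : ∀ i, Fin (n i) → ℝ) :
    (fun p : Σ i, Fin (n i) => x p.1 p.2) ⬝ᵥ unitTridiag U *ᵥ (fun p => x p.1 p.2) =
      chainForm 1 U x := by
  have hx : (fun p : Σ i, Fin (n i) => x p.1 p.2) ⬝ᵥ (fun p => x p.1 p.2) =
      x 0 ⬝ᵥ x 0 + ∑ k : Fin (L + 1), x k.succ ⬝ᵥ x k.succ := by
    rw [dotProduct, Fintype.sum_sigma, Fin.sum_univ_succ]
    rfl
  rw [unitTridiag, Matrix.sub_mulVec, Matrix.sub_mulVec, Matrix.one_mulVec, dotProduct_sub,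
    dotProduct_sub, Matrix.dotProduct_transpose_mulVec, dotProduct_subdiag_mulVec, hx, chainForm,
    Matrix.one_mulVec, Finset.sum_sub_distrib, ← Finset.mul_sum]
  ring

theorem exists_factorization_of_posSemidef_unitTridiag (hU : (unitTridiag U).PosSemidef) :
    ∃ (A : ∀ i, Matrix (Fin (n i)) (Fin (n i)) ℝ)
      (B : ∀ k : Fin (L + 1), Matrix (Fin (n k.succ)) (Fin (n k.castSucc)) ℝ),
      A 0 = 1 ∧ (∀ i, (A i).PosSemidef) ∧
        ∀ k, A k.succ * (A k.succ)ᵀ + B k * (B k)ᵀ = 1 ∧ U k = B k * (A k.castSucc)ᵀ :=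
  exists_chain_factorization fun x =>
    (hU.dotProduct_mulVec_nonneg _).trans_eq (dotProduct_unitTridiag_mulVec x)

theorem unitTridiag_eq_mul_transpose {A : ∀ i, Matrix (Fin (n i)) (Fin (n i)) ℝ}
    {B : ∀ k : Fin (L + 1), Matrix (Fin (n k.succ)) (Fin (n k.castSucc)) ℝ} (hA₀ : A 0 = 1)
    (hAB : ∀ k, A k.succ * (A k.succ)ᵀ + B k * (B k)ᵀ = 1)
    (hU : ∀ k, U k = B k * (A k.castSucc)ᵀ) :
    unitTridiag U =
      (Matrix.blockDiagonal' A - subdiag B) * (Matrix.blockDiagonal' A - subdiag B)ᵀ := by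
  set D := Matrix.blockDiagonal' A with hD
  have hBD : subdiag B * Dᵀ = subdiag U := by
    rw [hD, Matrix.blockDiagonal'_transpose, subdiag_mul_blockDiagonal', funext hU]
  have hDB : D * (subdiag B)ᵀ = (subdiag U)ᵀ := by
    rw [← hBD, Matrix.transpose_mul, Matrix.transpose_transpose]
  have hBB : subdiag B * (subdiag B)ᵀ = 1 - D * Dᵀ := by
    rw [subdiag_mul_transpose_self (D := fun i => 1 - A i * (A i)ᵀ), hD,
      Matrix.blockDiagonal'_transpose, ← Matrix.blockDiagonal'_mul, ← Matrix.blockDiagonal'_one,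
      ← Matrix.blockDiagonal'_sub]
    · rfl
    · simp [hA₀]
    · exact fun k => (eq_sub_of_add_eq' (hAB k)).symm
  rw [unitTridiag, Matrix.transpose_sub, mul_sub, sub_mul, sub_mul, hBD, hDB, hBB]
  abel

theorem posSemidef_unitTridiag {A : ∀ i, Matrix (Fin (n i)) (Fin (n i)) ℝ}
    {B : ∀ k : Fin (L + 1), Matrix (Fin (n k.succ)) (Fin (n k.castSucc)) ℝ} (hA₀ : A 0 = 1)
    (hAB : ∀ k, A k.succ * (A k.succ)ᵀ + B k * (B k)ᵀ = 1)
    (hU : ∀ k, U k = B k * (A k.castSucc)ᵀ) : (unitTridiag U).PosSemidef := by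
  rw [unitTridiag_eq_mul_transpose hA₀ hAB hU, ← Matrix.conjTranspose_eq_transpose_of_trivial]
  exact Matrix.posSemidef_self_mul_conjTranspose _

end LipschitzLMI

namespace LipschitzLMI

variable {L : ℕ} {n : Fin (L + 2) → ℕ}

/-- The multipliers `Λ_k = diag(exp d_k)²`. -/
noncomputable def multiplier (d : ∀ j : Fin L, Fin (n j.castSucc.succ) → ℝ) (j : Fin L)
    (a : Fin (n j.castSucc.succ)) : ℝ :=
  Real.exp (d j a) ^ 2

/-- The vectors `√γ, √2 exp d_0, …, √2 exp d_{L-1}, √γ`, whose entrywise squares are the diagonals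
of the diagonal blocks of `H` for the multipliers `Λ_k = diag(exp d_k)²`. -/
noncomputable def scale (γ : ℝ) (d : ∀ j : Fin L, Fin (n j.castSucc.succ) → ℝ)
    (i : Fin (L + 2)) : Fin (n i) → ℝ :=
  Fin.cases (motive := fun i : Fin (L + 2) => Fin (n i) → ℝ) (fun _ => √γ)
    (fun k => Fin.lastCases (motive := fun k : Fin (L + 1) => Fin (n k.succ) → ℝ)
      (fun _ => √γ) (fun j a => √2 * Real.exp (d j a)) k) i

variable {γ : ℝ} {d : ∀ j : Fin L, Fin (n j.castSucc.succ) → ℝ}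

theorem multiplier_pos (j : Fin L) (a : Fin (n j.castSucc.succ)) : 0 < multiplier d j a :=
  pow_pos (Real.exp_pos _) 2

theorem exists_multiplier_eq {lam : ∀ j : Fin L, Fin (n j.castSucc.succ) → ℝ}
    (hlam : ∀ j a, 0 < lam j a) : ∃ d, multiplier d = lam := by
  refine ⟨fun j a => Real.log (√(lam j a)), funext₂ fun j a => ?_⟩
  rw [multiplier, Real.exp_log (Real.sqrt_pos.mpr (hlam j a)), Real.sq_sqrt (hlam j a).le]

theorem scale_zero : scale γ d 0 = fun _ => √γ := rfl

theorem scale_succ_last : scale γ d (Fin.last L).succ = fun _ => √γ := by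
  simp only [scale, Fin.cases_succ, Fin.lastCases_last]

theorem scale_succ_castSucc (j : Fin L) :
    scale γ d j.castSucc.succ = fun a => √2 * Real.exp (d j a) := by
  simp only [scale, Fin.cases_succ, Fin.lastCases_castSucc]

theorem scale_pos (hγ : 0 < γ) (i : Fin (L + 2)) (a : Fin (n i)) : 0 < scale γ d i a := by
  have hsqrt : 0 < √γ := Real.sqrt_pos.mpr hγ
  cases i using Fin.cases with
  | zero => rwa [scale_zero]
  | succ k =>
    cases k using Fin.lastCases with
    | last => rwa [scale_succ_last]
    | cast j => rw [scale_succ_castSucc]; positivity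

theorem isUnit_diagonal_scale (hγ : 0 < γ) (i : Fin (L + 2)) :
    IsUnit (Matrix.diagonal (scale γ d i)) :=
  Matrix.isUnit_diagonal.mpr (Pi.isUnit_iff.mpr fun a => (scale_pos hγ i a).ne'.isUnit)

theorem diagBlock_multiplier (hγ : 0 ≤ γ) (i : Fin (L + 2)) :
    diagBlock γ (multiplier d) i =
      Matrix.diagonal (scale γ d i) * Matrix.diagonal (scale γ d i) := by
  rw [Matrix.diagonal_mul_diagonal]
  cases i using Fin.cases with
  | zero => simp only [diagBlock, Fin.cases_zero, scale_zero, Real.mul_self_sqrt hγ,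
      Matrix.smul_one_eq_diagonal]
  | succ k =>
    cases k using Fin.lastCases with
    | last => simp only [diagBlock, Fin.cases_succ, Fin.lastCases_last, scale_succ_last,
        Real.mul_self_sqrt hγ, Matrix.smul_one_eq_diagonal]
    | cast j =>
      simp only [diagBlock, Fin.cases_succ, Fin.lastCases_castSucc, scale_succ_castSucc,
        ← Matrix.diagonal_smul]
      refine congrArg Matrix.diagonal (funext fun a => ?_)
      rw [Pi.smul_apply, multiplier, smul_eq_mul, mul_mul_mul_comm,
        Real.mul_self_sqrt zero_le_two, sq]

/-- The blocks of `H` below the diagonal, up to sign, once its diagonal blocks have been scaled to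
identities. -/
noncomputable def normalizedWeight (γ : ℝ) (f : FeedforwardNetwork L n)
    (d : ∀ j : Fin L, Fin (n j.castSucc.succ) → ℝ) (k : Fin (L + 1)) :
    Matrix (Fin (n k.succ)) (Fin (n k.castSucc)) ℝ :=
  (Matrix.diagonal (scale γ d k.succ))⁻¹ * f.scaledWeight (multiplier d) k *
    (Matrix.diagonal (scale γ d k.castSucc))⁻¹

theorem normalizedWeight_eq_iff (hγ : 0 < γ) {f : FeedforwardNetwork L n} {k : Fin (L + 1)}
    {M : Matrix (Fin (n k.succ)) (Fin (n k.castSucc)) ℝ} :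
    normalizedWeight γ f d k = M ↔ f.scaledWeight (multiplier d) k =
      Matrix.diagonal (scale γ d k.succ) * M * Matrix.diagonal (scale γ d k.castSucc) := by
  have hdet (i : Fin (L + 2)) : IsUnit (Matrix.diagonal (scale γ d i)).det :=
    (Matrix.isUnit_iff_isUnit_det _).mp (isUnit_diagonal_scale hγ i)
  constructor
  · rintro rfl
    rw [normalizedWeight, Matrix.mul_assoc, Matrix.nonsing_inv_mul_cancel_right _ _ (hdet _),
      Matrix.mul_nonsing_inv_cancel_left _ _ (hdet _)]
  · intro h
    rw [normalizedWeight, h, Matrix.mul_assoc _ M, Matrix.nonsing_inv_mul_cancel_left _ _ (hdet _),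
      Matrix.mul_nonsing_inv_cancel_right _ _ (hdet _)]

theorem H_multiplier (hγ : 0 < γ) (f : FeedforwardNetwork L n) :
    H γ f (multiplier d) =
      Matrix.blockDiagonal' (fun i => Matrix.diagonal (scale γ d i)) *
        unitTridiag (normalizedWeight γ f d) *
        Matrix.blockDiagonal' (fun i => Matrix.diagonal (scale γ d i)) := by
  set Φ := Matrix.blockDiagonal' (fun i => Matrix.diagonal (scale γ d i)) with hΦ
  have hΦt : Φᵀ = Φ := by
    rw [hΦ, Matrix.blockDiagonal'_diagonal, Matrix.diagonal_transpose]
  have hdiag : Matrix.blockDiagonal' (diagBlock γ (multiplier d)) = Φ * Φ := by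
    rw [hΦ, ← Matrix.blockDiagonal'_mul, ← funext (diagBlock_multiplier hγ.le)]
  have hsub : subdiag (f.scaledWeight (multiplier d)) =
      Φ * subdiag (normalizedWeight γ f d) * Φ := by
    rw [hΦ, blockDiagonal'_mul_subdiag, subdiag_mul_blockDiagonal']
    exact congrArg subdiag (funext fun k => (normalizedWeight_eq_iff hγ).mp rfl)
  rw [H, hdiag, hsub, unitTridiag, Matrix.transpose_mul, Matrix.transpose_mul, hΦt,
    ← Matrix.mul_assoc, mul_sub, mul_sub, sub_mul, sub_mul, mul_one]

theorem posSemidef_H_multiplier_iff (hγ : 0 < γ) (f : FeedforwardNetwork L n) :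
    (H γ f (multiplier d)).PosSemidef ↔ (unitTridiag (normalizedWeight γ f d)).PosSemidef := by
  have hunit : IsUnit (Matrix.diagonal fun p : Σ i, Fin (n i) => scale γ d p.1 p.2) :=
    Matrix.isUnit_diagonal.mpr (Pi.isUnit_iff.mpr fun p => (scale_pos hγ p.1 p.2).ne'.isUnit)
  have h := Matrix.IsUnit.posSemidef_star_left_conjugate_iff hunit
    (x := unitTridiag (normalizedWeight γ f d))
  rwa [Matrix.star_eq_conjTranspose, Matrix.diagonal_conjTranspose, star_trivial,
    ← Matrix.blockDiagonal'_diagonal, ← H_multiplier hγ] at h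

end LipschitzLMI

namespace DirectParams

variable {L : ℕ} {n : Fin (L + 2) → ℕ}

theorem prevA_mul_transpose_add (θ : DirectParams L n) (k : Fin (L + 1)) :
    θ.prevA k.succ * (θ.prevA k.succ)ᵀ + θ.B k * (θ.B k)ᵀ = 1 := by
  have h := cayley_transpose_mul_self (θ.X k) (θ.Y k)
  rwa [← Matrix.fromRows_toRows (cayley (θ.X k) (θ.Y k)), Matrix.transpose_fromRows,
    Matrix.fromCols_mul_fromRows] at h

theorem isUnit_Ψ {γ : ℝ} (hγ : 0 < γ) (θ : DirectParams L n) (k : Fin (L + 1)) :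
    IsUnit (θ.Ψ γ k) := by
  cases k using Fin.lastCases with
  | last =>
    rw [Ψ, Fin.lastCases_last, Matrix.smul_one_eq_diagonal, Matrix.isUnit_diagonal, Pi.isUnit_iff]
    exact fun _ => (Real.sqrt_pos.mpr (div_pos two_pos hγ)).ne'.isUnit
  | cast j =>
    rw [Ψ, Fin.lastCases_castSucc, Matrix.isUnit_diagonal, Pi.isUnit_iff]
    exact fun a => (Real.exp_pos (θ.d j a)).ne'.isUnit

theorem sqrt_two_smul_prevΨ (γ : ℝ) (θ : DirectParams L n) (k : Fin (L + 1)) :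
    √2 • θ.prevΨ γ k.castSucc = Matrix.diagonal (LipschitzLMI.scale γ θ.d k.castSucc) := by
  cases k using Fin.cases with
  | zero =>
    rw [prevΨ, Fin.castSucc_zero, Fin.cases_zero, smul_smul, Matrix.smul_one_eq_diagonal,
      ← Real.sqrt_mul zero_le_two, mul_div_cancel₀ γ two_ne_zero, LipschitzLMI.scale_zero]
  | succ j =>
    change √2 • θ.Ψ γ j.castSucc = Matrix.diagonal (LipschitzLMI.scale γ θ.d j.castSucc.succ)
    rw [LipschitzLMI.scale_succ_castSucc, Ψ, Fin.lastCases_castSucc, ← Matrix.diagonal_smul]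
    rfl

theorem sqrt_two_smul_scaledWeight {γ : ℝ} (hγ : 0 < γ) (θ : DirectParams L n)
    (f : FeedforwardNetwork L n) (k : Fin (L + 1)) :
    √2 • f.scaledWeight (LipschitzLMI.multiplier θ.d) k =
      Matrix.diagonal (LipschitzLMI.scale γ θ.d k.succ) * (θ.Ψ γ k * f.W k) := by
  cases k using Fin.lastCases with
  | last =>
    rw [LipschitzLMI.scale_succ_last, FeedforwardNetwork.scaledWeight, Fin.lastCases_last, Ψ,
      Fin.lastCases_last, Matrix.smul_mul, Matrix.one_mul, ← Matrix.smul_one_eq_diagonal,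
      Matrix.smul_mul, Matrix.one_mul, smul_smul, ← Real.sqrt_mul hγ.le,
      mul_div_cancel₀ 2 hγ.ne']
  | cast j =>
    rw [LipschitzLMI.scale_succ_castSucc, FeedforwardNetwork.scaledWeight,
      Fin.lastCases_castSucc, Ψ, Fin.lastCases_castSucc, ← Matrix.mul_assoc,
      Matrix.diagonal_mul_diagonal, ← Matrix.smul_mul, ← Matrix.diagonal_smul]
    congr 2
    funext a
    rw [Pi.smul_apply, smul_eq_mul, LipschitzLMI.multiplier, sq, mul_assoc]

theorem weight_eq_iff {γ : ℝ} (hγ : 0 < γ) (θ : DirectParams L n) (f : FeedforwardNetwork L n)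
    (k : Fin (L + 1)) :
    f.W k = θ.weight γ k ↔
      LipschitzLMI.normalizedWeight γ f θ.d k = θ.B k * (θ.prevA k.castSucc)ᵀ := by
  have hΨ := (Matrix.isUnit_iff_isUnit_det _).mp (θ.isUnit_Ψ hγ k)
  set M := θ.B k * (θ.prevA k.castSucc)ᵀ
  set s := LipschitzLMI.scale γ θ.d
  set V := f.scaledWeight (LipschitzLMI.multiplier θ.d) k
  let : Invertible (θ.Ψ γ k) := (θ.isUnit_Ψ hγ k).invertible
  let : Invertible (Matrix.diagonal (s k.succ)) :=
    (LipschitzLMI.isUnit_diagonal_scale hγ k.succ).invertible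
  have hweight : θ.Ψ γ k * θ.weight γ k = √2 • (M * Matrix.diagonal (s k.castSucc)) := by
    rw [weight, ← sqrt_two_smul_prevΨ, Matrix.mul_smul, Matrix.mul_smul, smul_smul,
      Real.mul_self_sqrt zero_le_two, Matrix.mul_assoc (θ.Ψ γ k)⁻¹, Matrix.mul_assoc (θ.Ψ γ k)⁻¹,
      Matrix.mul_nonsing_inv_cancel_left _ _ hΨ]
  calc f.W k = θ.weight γ k
      ↔ Matrix.diagonal (s k.succ) * (θ.Ψ γ k * f.W k) =
          Matrix.diagonal (s k.succ) * (θ.Ψ γ k * θ.weight γ k) := by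
        rw [Matrix.mul_right_inj_of_invertible, Matrix.mul_right_inj_of_invertible]
    _ ↔ √2 • V =
          √2 • (Matrix.diagonal (s k.succ) * M * Matrix.diagonal (s k.castSucc)) := by
        rw [sqrt_two_smul_scaledWeight hγ, hweight, Matrix.mul_smul, Matrix.mul_assoc _ M]
    _ ↔ V = Matrix.diagonal (s k.succ) * M * Matrix.diagonal (s k.castSucc) :=
        (smul_right_injective _ (Real.sqrt_pos.mpr two_pos).ne').eq_iff
    _ ↔ LipschitzLMI.normalizedWeight γ f θ.d k = M :=
        (LipschitzLMI.normalizedWeight_eq_iff hγ).symm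

theorem exists_eq_of_factorization
    {A : ∀ i : Fin (L + 2), Matrix (Fin (n i)) (Fin (n i)) ℝ}
    {B : ∀ k : Fin (L + 1), Matrix (Fin (n k.succ)) (Fin (n k.castSucc)) ℝ}
    (d : ∀ j : Fin L, Fin (n j.castSucc.succ) → ℝ) (hA₀ : A 0 = 1)
    (hA : ∀ k : Fin (L + 1), IsUnit (1 + (A k.succ)ᵀ))
    (hAB : ∀ k, A k.succ * (A k.succ)ᵀ + B k * (B k)ᵀ = 1) :
    ∃ θ : DirectParams L n, θ.d = d ∧ θ.prevA = A ∧ θ.B = B := by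
  choose X Y hXY using fun k => exists_cayley_eq_fromRows (hAB k) (hA k)
  refine ⟨⟨d, X, Y⟩, rfl, funext fun i => ?_, funext fun k => ?_⟩
  · cases i using Fin.cases with
    | zero => exact hA₀.symm
    | succ k =>
      rw [prevA, Fin.cases_succ, DirectParams.A, hXY, Matrix.toRows₁_fromRows,
        Matrix.transpose_transpose]
  · rw [DirectParams.B, hXY, Matrix.toRows₂_fromRows, Matrix.transpose_transpose]

end DirectParams

/-- For a prescribed bound `γ > 0`, a feedforward network satisfies the LMI if and only if its
weights are produced by the direct parameterization from some free parameters. -/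
theorem theorem3p2 (L : ℕ) (n : Fin (L + 2) → ℕ) (γ : ℝ) (hγ : 0 < γ)
    (f : FeedforwardNetwork L n) :
    f.SatisfiesLMI γ ↔ ∃ θ : DirectParams L n, ∀ k : Fin (L + 1), f.W k = θ.weight γ k := by
  constructor
  · rintro ⟨lam, hlam, hH⟩
    obtain ⟨d, rfl⟩ := LipschitzLMI.exists_multiplier_eq hlam
    obtain ⟨A, B, hA₀, hA, hBA⟩ :=
      LipschitzLMI.exists_factorization_of_posSemidef_unitTridiag
        ((LipschitzLMI.posSemidef_H_multiplier_iff hγ f).mp hH)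
    have hunit (k : Fin (L + 1)) : IsUnit (1 + (A k.succ)ᵀ) :=
      (Matrix.PosDef.one.add_posSemidef (hA k.succ).transpose).isUnit
    obtain ⟨θ, rfl, rfl, rfl⟩ :=
      DirectParams.exists_eq_of_factorization d hA₀ hunit fun k => (hBA k).1
    exact ⟨θ, fun k => (θ.weight_eq_iff hγ f k).mpr (hBA k).2⟩
  · rintro ⟨θ, hW⟩
    refine ⟨LipschitzLMI.multiplier θ.d, LipschitzLMI.multiplier_pos, ?_⟩
    rw [LipschitzLMI.posSemidef_H_multiplier_iff hγ]
    exact LipschitzLMI.posSemidef_unitTridiag rfl θ.prevA_mul_transpose_add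
      fun k => (θ.weight_eq_iff hγ f k).mp (hW k)
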